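/- Let $\lambda$ be a regular uncountable cardinal, let $2^{<\lambda}=\sup\{2^{\kappa}:\kappa<\lambda \text{ a cardinal}\}$, and let ${}^{\alpha}2$ denote the set of all functions $\alpha\to\{0,1\}$. Let $S\subseteq\lambda$ be a stationary set with the weak diamond property $\Phi_\lambda(S)$, that is: for every function $c:\bigcup_{\alpha<\lambda}{}^{\alpha}2\to\{0,1\}$ there is $\eta\in{}^{\lambda}2$ such that for all $f\in{}^{\lambda}2$ the set $\{\delta\in S: c(f\restriction\delta)=\eta(\delta)\}$ is stationary in $\lambda$. Let $A$ be a set of cardinality $2^{<\lambda}$, and for every $\eta\in{}^{\lambda}2$ let $C_\eta$ be a closed unbounded subset of $\lambda$ and $\Theta_\eta:\lambda\to A$ a function. Then there are $\alpha<\lambda$ and $\eta_0,\eta_1\in{}^{\lambda}2$ such that 1. $\eta_0\restriction\alpha=\eta_1\restriction\alpha$; 2. $\eta_0(\alpha)=0$ and $\eta_1(\alpha)=1$; 3. $\Theta_{\eta_0}\restriction\alpha=\Theta_{\eta_1}\restriction\alpha$; 4. $\alpha\in C_{\eta_0}$. -/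

import Mathlib

universe u v

open Cardinal

/-- The set of ordinals below the initial ordinal of the cardinal `κ`, i.e. the cardinal `κ` itself
in the von Neumann sense, with its well-order. -/
abbrev OrdBelow (κ : Cardinal.{u}) : Type (u + 1) := Set.Iio κ.ord

/-- The set `D` of all functions `f : α → {0, 1}` with `α < κ`, each one recorded together with its
domain `α`, the set of ordinals below `α`. -/
abbrev BinarySeq (κ : Cardinal.{u}) : Type (u + 1) :=
  Σ α : OrdBelow κ, (Set.Iio α → Fin 2)

/-- The weak diamond property of a set `S ⊆ κ`: for every colouring `c : D → {0, 1}` there is a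
weak diamond function `η : κ → {0, 1}` such that, for every `f : κ → {0, 1}`, the set of all
`δ ∈ S` with `c (f ↾ δ) = η δ` is stationary in `κ`. -/
def WeakDiamond (κ : Cardinal.{u}) (S : Set (OrdBelow κ)) : Prop :=
  ∀ c : BinarySeq κ → Fin 2, ∃ η : OrdBelow κ → Fin 2, ∀ f : OrdBelow κ → Fin 2,
    IsStationary {δ : OrdBelow κ | δ ∈ S ∧ c ⟨δ, (Set.Iio δ).domRestrict f⟩ = η δ}

/-!
Suppose that every pair `(η, Θ η)` is coded by a single sequence `f η : κ → {0, 1}` in such a way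
that, for all `δ` in a club `E η`, the restriction of `f η` to `δ` determines the restrictions of
`η` and `Θ η` to `δ`. Colour a sequence `g` of length `δ` with `1` if some `η₀` with
`δ ∈ C η₀ ∩ E η₀` and `η₀ δ = 0` has `f η₀ ↾ δ = g`, and with `0` otherwise. Let `η` be a weak
diamond function for this colouring, and apply it to the sequence `f η` that codes `η` itself: some
`δ ∈ C η ∩ E η` has the colour of `f η ↾ δ` equal to `η δ`. If `η δ = 0`, then `η` witnesses that
the colour is `1`, a contradiction. So `η δ = 1`, and the `η₀` that witnesses the colour `1`
provides the pair `η₀, η`, with `α = δ`.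

The coding (`exists_coding`) sends the elements of `A` injectively to bounded subsets of `κ`, which
is possible because there are at least `2 ^< κ` of these
(`lift_two_powerlt_le_mk_bddAbove_set`), and then packs `η` and the characteristic functions of all
these sets into one sequence by means of an injection `Option κ × κ → κ`. The club consists of the
`δ` closed under this injection and under bounds of the sets that code `Θ η i`
(`isClub_closurePoints`).
-/

section WellOrder

variable {α : Type v} [LinearOrder α]

theorem exists_forall_lt_of_mk_lt_cof {ι : Type u} (f : ι → α)
    (hι : Cardinal.lift.{v} #ι < Cardinal.lift.{u} (Order.cof α)) : ∃ b, ∀ i, f i < b := by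
  have h : ¬ IsCofinal (Set.range f) := fun h ↦ by
    have h₁ := Cardinal.lift_le.{u}.2 (Order.cof_le h)
    exact (h₁.trans mk_range_le_lift).not_gt hι
  obtain ⟨b, hb⟩ := not_isCofinal_iff.1 h
  exact ⟨b, fun i ↦ hb _ ⟨i, rfl⟩⟩

theorem mk_Iic_lt_cof (hcof : ℵ₀ < Order.cof α)
    (hα : ∀ x : α, #(Set.Iio x) < Order.cof α) (x : α) : #(Set.Iic x) < Order.cof α := by
  obtain ⟨y, hy⟩ := exists_forall_lt_of_mk_lt_cof (fun _ : Unit ↦ x)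
    (by simpa using Cardinal.one_lt_aleph0.trans hcof)
  exact (Cardinal.mk_le_mk_of_subset fun z hz ↦ lt_of_le_of_lt hz (hy ())).trans_lt (hα y)

theorem isClub_closurePoints [WellFoundedLT α] (hcof : ℵ₀ < Order.cof α)
    (hα : ∀ x : α, #(Set.Iio x) < Order.cof α) (g : α → α) :
    IsClub {δ : α | ∀ x < δ, g x < δ} := by
  refine ⟨fun t ht _ _ δ hδ x hx ↦ ?_, fun a ↦ ?_⟩
  · obtain ⟨d, hd, hxd⟩ := (lt_isLUB_iff hδ).1 hx
    exact (ht hd x hxd).trans_le (hδ.1 hd)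
  · have hG : ∀ x, ∃ y, ∀ z : Set.Iic x, g z < y := fun x ↦
      exists_forall_lt_of_mk_lt_cof _ (Cardinal.lift_lt.2 (mk_Iic_lt_cof hcof hα x))
    choose G hG using hG
    let s : ℕ → α := fun n ↦ G^[n] a
    -- The least strict upper bound of the iterates of `G` starting from `a` is a closure point.
    obtain ⟨b, hb⟩ := exists_forall_lt_of_mk_lt_cof s (by simpa using hcof)
    let T : Set α := {b | ∀ n, s n < b}
    obtain ⟨δ, hδ, hmin⟩ := wellFounded_lt.has_min T ⟨b, hb⟩
    refine ⟨δ, fun x hx ↦ ?_, (hδ 0).le⟩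
    have hx' : ∃ n, x ≤ s n := by
      by_contra! h
      exact hmin x h hx
    obtain ⟨n, hn⟩ := hx'
    refine (hG (s n) ⟨x, hn⟩).trans ?_
    have := hδ (n + 1)
    simpa only [s, Function.iterate_succ_apply'] using this

/-- A pair consisting of `η : α → {0, 1}` and `θ : α → A` can be coded by one sequence
`α → {0, 1}` such that initial segments of the code, of length in a club depending on the pair,
determine initial segments of the pair, provided that `A` injects into the bounded subsets
of `α`. -/
theorem exists_coding [WellFoundedLT α] (hcof : ℵ₀ < Order.cof α)
    (hα : ∀ x : α, #(Set.Iio x) < Order.cof α) {A : Type*}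
    (e : A ↪ {s : Set α // BddAbove s}) :
    ∃ (f : (α → Fin 2) × (α → A) → α → Fin 2) (E : (α → Fin 2) × (α → A) → Set α),
      (∀ p, IsClub (E p)) ∧ ∀ p q, ∀ δ ∈ E p, δ ∈ E q → (∀ i < δ, f p i = f q i) →
        (∀ i < δ, p.1 i = q.1 i) ∧ ∀ i < δ, p.2 i = q.2 i := by
  classical
  have hinf : ℵ₀ ≤ #α := (hcof.trans_le (Order.cof_le_cardinalMk α)).le
  have : Infinite α := Cardinal.infinite_iff.2 hinf
  obtain ⟨P⟩ : Nonempty (Option α × α ↪ α) := by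
    rw [← Cardinal.le_def]
    simp [Cardinal.mk_option, Cardinal.add_one_eq hinf, Cardinal.mul_eq_self hinf]
  have hB : ∀ x : α, ∃ y, ∀ z : Option (Set.Iic x) × Set.Iic x,
      P (z.1.map Subtype.val, z.2) < y := fun x ↦ by
    refine exists_forall_lt_of_mk_lt_cof _ (Cardinal.lift_lt.2 ?_)
    have h := mk_Iic_lt_cof hcof hα x
    rw [Cardinal.mk_prod, Cardinal.lift_id, Cardinal.lift_id, Cardinal.mk_option]
    exact Cardinal.mul_lt_of_lt hcof.le
      (Cardinal.add_lt_of_lt hcof.le h (Cardinal.one_lt_aleph0.trans hcof)) h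
  choose B hB using hB
  choose b hb using fun a : A ↦ (e a).2
  let g : (α → Fin 2) × (α → A) → Option α × α → Fin 2 := fun p z ↦
    z.1.elim (p.1 z.2) fun j ↦ if j ∈ (e (p.2 z.2)).1 then 1 else 0
  refine ⟨fun p ↦ Function.extend P (g p) 0,
    fun p ↦ {δ | ∀ x < δ, max (B x) (b (p.2 x)) < δ},
    fun p ↦ isClub_closurePoints hcof hα _, fun p q δ hp hq h ↦ ?_⟩
  have key : ∀ z : Option α × α, P z < δ → g p z = g q z := fun z hz ↦ by
    simpa [P.injective.extend_apply] using h _ hz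
  refine ⟨fun i hi ↦ key (none, i) ?_, fun i hi ↦ e.injective (Subtype.ext (Set.ext fun j ↦ ?_))⟩
  · exact (hB i (none, ⟨i, le_rfl⟩)).trans ((le_max_left _ _).trans_lt (hp i hi))
  · obtain hj | hj := lt_or_ge j δ
    · have hm : max i j < δ := max_lt hi hj
      have := key (some j, i) ((hB (max i j) (some ⟨j, le_max_right _ _⟩, ⟨i, le_max_left _ _⟩)).trans
        ((le_max_left _ _).trans_lt (hp _ hm)))
      simp only [g, Option.elim] at this
      split_ifs at this <;> simp_all
    · -- Beyond `δ` both sets are empty, as `δ` exceeds the chosen bounds.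
      have h₁ : j ∉ (e (p.2 i)).1 := fun hmem ↦
        ((hb _ hmem).trans_lt ((le_max_right _ _).trans_lt (hp i hi))).not_ge hj
      have h₂ : j ∉ (e (q.2 i)).1 := fun hmem ↦
        ((hb _ hmem).trans_lt ((le_max_right _ _).trans_lt (hq i hi))).not_ge hj
      exact iff_of_false h₁ h₂

end WellOrder

theorem cof_ordBelow {κ : Cardinal.{u}} (hreg : κ.IsRegular) :
    Order.cof (OrdBelow κ) = Cardinal.lift.{u + 1} κ := by
  rw [Ordinal.cof_Iio, ← Ordinal.lift_cof, hreg.cof_ord]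

theorem mk_Iio_ordBelow_lt {κ : Cardinal.{u}} (x : OrdBelow κ) :
    #(Set.Iio x) < Cardinal.lift.{u + 1} κ := by
  have h : #(Set.Iio x) ≤ #(Set.Iio x.1) :=
    Cardinal.mk_le_of_injective (f := fun y ↦ (⟨y.1.1, y.2⟩ : Set.Iio x.1))
      fun y z hyz ↦ Subtype.ext (Subtype.ext (Subtype.mk.inj hyz))
  refine h.trans_lt ?_
  rw [Cardinal.mk_Iio_ordinal]
  exact Cardinal.lift_lt.2 (Cardinal.lt_ord.1 x.2)

theorem lift_two_powerlt_le_mk_bddAbove_set (κ : Cardinal.{u}) :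
    Cardinal.lift.{u + 1} (2 ^< κ) ≤ #{s : Set (OrdBelow κ) // BddAbove s} := by
  by_contra! h
  obtain ⟨c, hc, hlt⟩ := Cardinal.lt_lift_iff.1 h
  have : ∃ μ < κ, c < 2 ^ μ := by
    by_contra! hle
    exact (Cardinal.powerlt_le.2 hle).not_gt hc
  obtain ⟨μ, hμ, hcμ⟩ := this
  refine (Cardinal.lift_lt.{u, u + 1}.2 hcμ).not_ge ?_
  have hlt' : μ.ord < κ.ord := Cardinal.ord_lt_ord.2 hμ
  rw [hlt, Cardinal.lift_two_power, ← Cardinal.card_ord μ, ← Cardinal.mk_Iio_ordinal,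
    ← Cardinal.mk_set]
  let i : Set.Iio μ.ord → OrdBelow κ := fun y ↦ ⟨y.1, lt_trans y.2 hlt'⟩
  have hi : i.Injective := fun y z hyz ↦ Subtype.ext (Subtype.mk.inj hyz)
  refine Cardinal.mk_le_of_injective (f := fun s : Set (Set.Iio μ.ord) ↦
    (⟨i '' s, ⟨μ.ord, hlt'⟩, ?_⟩ : {s : Set (OrdBelow κ) // BddAbove s})) fun s t hst ↦ ?_
  · rintro _ ⟨y, -, rfl⟩
    exact le_of_lt y.2
  · exact hi.image_injective (congrArg Subtype.val hst)

theorem lemma2p2 (κ : Cardinal.{u}) (hreg : κ.IsRegular) (hunc : ℵ₀ < κ)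
    (S : Set (OrdBelow κ)) (hS : IsStationary S) (hΦ : WeakDiamond κ S)
    (A : Type v) (hA : Cardinal.lift.{u} #A = Cardinal.lift.{v} (2 ^< κ))
    (C : (OrdBelow κ → Fin 2) → Set (OrdBelow κ)) (hC : ∀ η, IsClub (C η))
    (Θ : (OrdBelow κ → Fin 2) → OrdBelow κ → A) :
    ∃ (α : OrdBelow κ) (η₀ η₁ : OrdBelow κ → Fin 2),
      (Set.Iio α).domRestrict η₀ = (Set.Iio α).domRestrict η₁ ∧
      η₀ α = 0 ∧ η₁ α = 1 ∧
      (Set.Iio α).domRestrict (Θ η₀) = (Set.Iio α).domRestrict (Θ η₁) ∧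
      α ∈ C η₀ := by
  classical
  have hcof : ℵ₀ < Order.cof (OrdBelow κ) := by
    rw [cof_ordBelow hreg]
    simpa using hunc
  have hIio : ∀ x : OrdBelow κ, #(Set.Iio x) < Order.cof (OrdBelow κ) := fun x ↦ by
    rw [cof_ordBelow hreg]
    exact mk_Iio_ordBelow_lt x
  obtain ⟨e⟩ : Nonempty (A ↪ {s : Set (OrdBelow κ) // BddAbove s}) := by
    rw [← Cardinal.lift_mk_le']
    have h₁ := congrArg Cardinal.lift.{u + 1} hA
    have h₂ := Cardinal.lift_le.{v}.2 (lift_two_powerlt_le_mk_bddAbove_set κ)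
    rw [Cardinal.lift_lift, Cardinal.lift_lift] at h₁
    rw [Cardinal.lift_lift] at h₂
    exact h₁.le.trans h₂
  obtain ⟨f, E, hE, hf⟩ := exists_coding hcof hIio e
  -- `F η` codes the pair `(η, Θ η)`, correctly at the points of `D η`.
  let F : (OrdBelow κ → Fin 2) → OrdBelow κ → Fin 2 := fun η ↦ f (η, Θ η)
  let D : (OrdBelow κ → Fin 2) → Set (OrdBelow κ) := fun η ↦ C η ∩ E (η, Θ η)
  let c : BinarySeq κ → Fin 2 := fun g ↦
    if ∃ η₀, g.1 ∈ D η₀ ∧ η₀ g.1 = 0 ∧ (Set.Iio g.1).domRestrict (F η₀) = g.2 then 1 else 0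
  obtain ⟨η, hη⟩ := hΦ c
  obtain ⟨δ, ⟨-, hδ⟩, hδD⟩ := hη (F η) ((hC η).inter hcof.ne' (hE (η, Θ η)))
  by_cases h : ∃ η₀, δ ∈ D η₀ ∧ η₀ δ = 0 ∧
      (Set.Iio δ).domRestrict (F η₀) = (Set.Iio δ).domRestrict (F η)
  · have hη₁ : η δ = 1 := by rw [← hδ]; exact if_pos h
    obtain ⟨η₀, hD, h₀, hF⟩ := h
    obtain ⟨h₁, h₂⟩ := hf (η₀, Θ η₀) (η, Θ η) δ hD.2 hδD.2 fun i hi ↦ congrFun hF ⟨i, hi⟩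
    exact ⟨δ, η₀, η, funext fun i ↦ h₁ i i.2, h₀, hη₁, funext fun i ↦ h₂ i i.2, hD.1⟩
  · have hη₀ : η δ = 0 := by rw [← hδ]; exact if_neg h
    exact absurd ⟨η, hδD, hη₀, rfl⟩ h
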